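/- Consider the category $\mathrm{Set}$ with its cartesian monoidal structure $(\times,1)$. A bimonad on it is a monad $(T,\mu,\eta)$ with a comonoidal structure $T_2(X,Y):T(X\times Y)\to T(X)\times T(Y)$, $T_0:T(1)\to 1$ for which $\mu$ and $\eta$ are comonoidal natural transformations. It is a Hopf monad if the fusion operators $T(X\times T(Y))\to T(X)\times T(Y)$, $(\mathrm{id}\times\mu_Y)\circ T_2(X,T(Y))$, and $T(T(X)\times Y)\to T(X)\times T(Y)$, $(\mu_X\times\mathrm{id})\circ T_2(T(X),Y)$, are bijective for all sets $X,Y$. It is finitary if $T$ preserves filtered colimits, and non-degenerate if some $T$-module (Eilenberg–Moore algebra) has at least two elements. It is augmented if there is a bimonad morphism from $T$ to the identity bimonad. 1. Let $T$ be a non-degenerate finitary Hopf monad on $(\mathrm{Set},\times,1)$. Then there is a group $G$ such that $T$ is isomorphic, as a bimonad, to $G\times -$ (with monad structure given by the group structure of $G$ and comonoidal structure $(g,(x,y))\mapsto((g,x),(g,y))$). In particular, $T$ is augmented. 2. Let $\mathbb{T}$ be a Lawvere theory with some model having at least two elements, and suppose that the category of models of $\mathbb{T}$ (finite-product-preserving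 functors $\mathbb{T}\to\mathrm{Set}$) is cartesian closed and that the forgetful functor $M\mapsto M(1)$ to $\mathrm{Set}$ preserves exponentials. Then $\mathbb{T}$ is isomorphic, as a Lawvere theory, to the theory of $G$-sets for some group $G$. Moreover, every unary operation of $\mathbb{T}$ is invertible (with a unary operation as its inverse), and every operation $\rho\in\mathbb{T}(n,1)$ is of the form $u\circ\sigma_i$ with $u\in\mathbb{T}(1,1)$ and $\sigma_i:n\to 1$ a projection, $1\le i\le n$ (in particular there are no operations of arity $0$). -/

import Mathlib

open CategoryTheory MonoidalCategory Limits

universe v u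

/-! ## Bimonads and Hopf monads on a monoidal category -/

section Bimonads

variable (C : Type u) [Category.{v} C] [MonoidalCategory C]

/-- A bimonad (comonoidal monad) on a monoidal category: a monad `T` with a comonoidal (oplax
monoidal) structure on its functor, `δ X Y : T (X ⊗ Y) ⟶ T X ⊗ T Y` and `η : T 𝟙 ⟶ 𝟙`, such that
the multiplication and the unit of the monad are comonoidal natural transformations. -/
structure Bimonad where
  /-- the underlying monad -/
  monad : Monad C
  /-- the comonoidal structure -/
  oplax : monad.toFunctor.OplaxMonoidal
  mul_tensor : ∀ X Y : C,
    monad.μ.app (X ⊗ Y) ≫ oplax.δ X Y =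
      monad.map (oplax.δ X Y) ≫ oplax.δ (monad.obj X) (monad.obj Y) ≫
        (monad.μ.app X ⊗ₘ monad.μ.app Y)
  unit_tensor : ∀ X Y : C,
    monad.η.app (X ⊗ Y) ≫ oplax.δ X Y = (monad.η.app X ⊗ₘ monad.η.app Y)
  mul_unit : monad.μ.app (𝟙_ C) ≫ oplax.η = monad.map oplax.η ≫ oplax.η
  unit_unit : monad.η.app (𝟙_ C) ≫ oplax.η = 𝟙 (𝟙_ C)

namespace Bimonad

variable {C}

/-- The left fusion operator `T (X ⊗ T Y) ⟶ T X ⊗ T Y`. -/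
def leftFusion (T : Bimonad C) (X Y : C) :
    T.monad.obj (X ⊗ T.monad.obj Y) ⟶ T.monad.obj X ⊗ T.monad.obj Y :=
  T.oplax.δ X (T.monad.obj Y) ≫ T.monad.obj X ◁ T.monad.μ.app Y

/-- The right fusion operator `T (T X ⊗ Y) ⟶ T X ⊗ T Y`. -/
def rightFusion (T : Bimonad C) (X Y : C) :
    T.monad.obj (T.monad.obj X ⊗ Y) ⟶ T.monad.obj X ⊗ T.monad.obj Y :=
  T.oplax.δ (T.monad.obj X) Y ≫ T.monad.μ.app X ▷ T.monad.obj Y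

/-- A Hopf monad is a bimonad whose left and right fusion operators are invertible. -/
def IsHopf (T : Bimonad C) : Prop :=
  (∀ X Y : C, IsIso (T.leftFusion X Y)) ∧ (∀ X Y : C, IsIso (T.rightFusion X Y))

/-- A morphism of bimonads is a morphism of monads which is a comonoidal natural
transformation. -/
structure IsBimonadHom (S T : Bimonad C) (f : S.monad ⟶ T.monad) : Prop where
  tensor : ∀ X Y : C,
    f.app (X ⊗ Y) ≫ T.oplax.δ X Y = S.oplax.δ X Y ≫ (f.app X ⊗ₘ f.app Y)
  unit : f.app (𝟙_ C) ≫ T.oplax.η = S.oplax.η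

/-- Two bimonads are isomorphic if there is an isomorphism of monads between them which is
comonoidal (its inverse is then comonoidal as well). -/
def IsIsomorphic (S T : Bimonad C) : Prop :=
  ∃ e : S.monad ≅ T.monad, IsBimonadHom S T e.hom

variable (C) in
/-- The identity bimonad. -/
def identity : Bimonad C where
  monad := Monad.id C
  oplax :=
    { η := 𝟙 (𝟙_ C)
      δ := fun X Y => 𝟙 (X ⊗ Y)
      δ_natural_left := fun f X => by simp [Monad.id]
      δ_natural_right := fun X f => by simp [Monad.id]
      oplax_associativity := fun X Y Z => by simp [Monad.id]
      oplax_left_unitality := fun X => by simp [Monad.id]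
      oplax_right_unitality := fun X => by simp [Monad.id] }
  mul_tensor X Y := by simp [Monad.id]
  unit_tensor X Y := by simp [Monad.id]
  mul_unit := by simp [Monad.id]
  unit_unit := by simp [Monad.id]

/-- A bimonad is augmented if it admits a bimonad morphism to the identity bimonad. -/
def IsAugmented (T : Bimonad C) : Prop :=
  ∃ ε : T.monad ⟶ (identity C).monad, IsBimonadHom T (identity C) ε

/-- A bimonad is finitary if its functor preserves filtered colimits. -/
def IsFinitary (T : Bimonad C) : Prop :=
  PreservesFilteredColimits T.monad.toFunctor

/-- A bimonad on the category of sets is non-degenerate if some module (Eilenberg-Moore algebra)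
over it has at least two elements. -/
def IsNondegenerate (T : Bimonad (Type u)) : Prop :=
  ∃ A : T.monad.Algebra, Nontrivial A.A

/-- The bimonad `G × -` of a group `G` on the category of sets: multiplication and unit come
from those of `G`, and the comonoidal structure is `(g, (x, y)) ↦ ((g, x), (g, y))`. -/
def ofGroup (G : Type u) [Group G] : Bimonad (Type u) where
  monad :=
    { obj := fun X => G × X
      map := fun f => ↾(fun p => (p.1, f p.2))
      η := { app := fun X => ↾(fun x => ((1 : G), x)) }
      μ := { app := fun X => ↾(fun p : G × (G × X) => (p.1 * p.2.1, p.2.2)) }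
      assoc := fun X => by
        ext p
        · exact (mul_assoc p.1 p.2.1 p.2.2.1).symm
        · rfl
      left_unit := fun X => by
        ext p
        · exact one_mul p.1
        · rfl
      right_unit := fun X => by
        ext p
        · exact mul_one p.1
        · rfl }
  oplax :=
    { η := ↾(fun _ => PUnit.unit)
      δ := fun X Y => ↾(fun p : G × (X × Y) => ((p.1, p.2.1), (p.1, p.2.2)))
      δ_natural_left := fun _ _ => rfl
      δ_natural_right := fun _ _ => rfl
      oplax_associativity := fun _ _ _ => rfl
      oplax_left_unitality := fun _ => rfl
      oplax_right_unitality := fun _ => rfl }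
  mul_tensor _ _ := rfl
  unit_tensor _ _ := rfl
  mul_unit := rfl
  unit_unit := rfl

end Bimonad

end Bimonads

/-! ## Lawvere theories -/

/-- A Lawvere theory. It is presented as a category with object set `ℕ` (`Hom n m` is the set of
morphisms `n ⟶ m`) together with the action `t` on morphisms of an identity-on-objects functor from
the opposite of the category of the sets `Fin n`, such that `n` is, for every `n`, the `n`-th power
of `1` with projections `t (fun _ => i)`, that is, the functor strictly preserves finite
products. -/
structure LawvereTheory where
  Hom : ℕ → ℕ → Type u
  id : ∀ n, Hom n n
  comp : ∀ {n m k}, Hom n m → Hom m k → Hom n k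
  id_comp : ∀ {n m} (f : Hom n m), comp (id n) f = f
  comp_id : ∀ {n m} (f : Hom n m), comp f (id m) = f
  assoc : ∀ {n m k l} (f : Hom n m) (g : Hom m k) (h : Hom k l),
    comp (comp f g) h = comp f (comp g h)
  t : ∀ {m n : ℕ}, (Fin m → Fin n) → Hom n m
  t_id : ∀ n, t (fun i : Fin n => i) = id n
  t_comp : ∀ {m n k : ℕ} (α : Fin m → Fin n) (β : Fin n → Fin k),
    t (fun i => β (α i)) = comp (t β) (t α)
  isPower : ∀ m n : ℕ, Function.Bijective
    (fun (f : Hom m n) (i : Fin n) => comp f (t (fun _ : Fin 1 => i)))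

namespace LawvereTheory

/-- The projection `n ⟶ 1` to the `i`-th factor. -/
def proj (𝕋 : LawvereTheory.{u}) {n : ℕ} (i : Fin n) : 𝕋.Hom n 1 :=
  𝕋.t (fun _ : Fin 1 => i)

/-- The objects of the category `𝕋`, a copy of `ℕ`. -/
structure Obj (𝕋 : LawvereTheory.{u}) : Type where
  arity : ℕ

instance (𝕋 : LawvereTheory.{u}) : Category.{u} 𝕋.Obj where
  Hom n m := 𝕋.Hom n.arity m.arity
  id n := 𝕋.id n.arity
  comp f g := 𝕋.comp f g
  id_comp f := 𝕋.id_comp f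
  comp_id f := 𝕋.comp_id f
  assoc f g h := 𝕋.assoc f g h

/-- The models of `𝕋`: the functors `𝕋 ⥤ Type u` which preserve finite products. -/
def isModel (𝕋 : LawvereTheory.{u}) : ObjectProperty (𝕋.Obj ⥤ Type u) :=
  fun M => PreservesFiniteProducts M

/-- The category of models of `𝕋`, a full subcategory of the functor category. -/
abbrev Model (𝕋 : LawvereTheory.{u}) : Type (u + 1) :=
  𝕋.isModel.FullSubcategory

/-- The forgetful functor from models to sets, `M ↦ M(1)`. -/
abbrev forget (𝕋 : LawvereTheory.{u}) : 𝕋.Model ⥤ Type u :=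
  𝕋.isModel.ι ⋙ (evaluation 𝕋.Obj (Type u)).obj ⟨1⟩

/-- Products of models in the functor category are models. In particular the category of models has
finite products, computed pointwise. -/
instance (𝕋 : LawvereTheory.{u}) (J : Type) [SmallCategory J] :
    𝕋.isModel.IsClosedUnderLimitsOfShape J where
  limitsOfShape_le := by
    rintro G ⟨h⟩
    refine ⟨fun n => ?_⟩
    have : ∀ j, PreservesLimitsOfShape (Discrete (Fin n)) (h.diag.obj j) := fun j =>
      (h.prop_diag_obj j).preserves n
    have : PreservesLimitsOfShape (Discrete (Fin n)) h.diag.flip := ⟨fun {F} ↦ ⟨fun {c} hc ↦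
      ⟨evaluationJointlyReflectsLimits _
        (fun k' ↦ isLimitOfPreserves (h.diag.obj k') hc)⟩⟩⟩
    let e : h.diag.flip ⋙ lim ≅ G :=
      NatIso.ofComponents
        (fun j ↦ (limit.isLimit (h.diag.flip.obj j)).conePointUniqueUpToIso
          (isLimitOfPreserves ((evaluation _ _).obj j) h.isLimit))
        (fun {x y} f => by
          refine (isLimitOfPreserves ((evaluation _ _).obj y) h.isLimit).hom_ext fun k => ?_
          have h₁ := (limit.isLimit (h.diag.flip.obj y)).conePointUniqueUpToIso_hom_comp
            (isLimitOfPreserves ((evaluation _ _).obj y) h.isLimit) k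
          have h₂ := (limit.isLimit (h.diag.flip.obj x)).conePointUniqueUpToIso_hom_comp
            (isLimitOfPreserves ((evaluation _ _).obj x) h.isLimit) k
          simp at h₁ h₂ ⊢
          rw [h₁, reassoc_of% h₂, limMap_π]
          rfl)
    exact preservesLimitsOfShape_of_natIso e

/-- The theory lifts the cartesian closed structure of sets: its category of models is cartesian
closed and the forgetful functor preserves exponentials. -/
def LiftsCartesianClosed (𝕋 : LawvereTheory.{u}) : Prop :=
  ∃ _ : MonoidalClosed 𝕋.Model, MonoidalClosedFunctor 𝕋.forget

/-- A theory is non-degenerate if some model has at least two elements. -/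
def IsNondegenerate (𝕋 : LawvereTheory.{u}) : Prop :=
  ∃ M : 𝕋.Model, Nontrivial (𝕋.forget.obj M)

/-- Two Lawvere theories are isomorphic if there is an isomorphism of categories between them which
is the identity on objects and commutes with the functors from the opposite of the category of
finite sets. -/
def IsIsomorphic (𝕊 𝕋 : LawvereTheory.{u}) : Prop :=
  ∃ e : ∀ n m : ℕ, 𝕊.Hom n m ≃ 𝕋.Hom n m,
    (∀ n, e n n (𝕊.id n) = 𝕋.id n) ∧
    (∀ (n m k : ℕ) (f : 𝕊.Hom n m) (g : 𝕊.Hom m k),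
      e n k (𝕊.comp f g) = 𝕋.comp (e n m f) (e m k g)) ∧
    (∀ (m n : ℕ) (α : Fin m → Fin n), e n m (𝕊.t α) = 𝕋.t α)

/-- The theory of `G`-sets: a morphism `n ⟶ m` is an `m`-tuple of pairs `(g, j)` with `g : G` and
`j : Fin n`, and such a pair stands for the `n`-ary operation `x ↦ g • x j` on `G`-sets. -/
def ofGroup (G : Type u) [Group G] : LawvereTheory.{u} where
  Hom n m := Fin m → G × Fin n
  id n := fun i => (1, i)
  comp f g := fun i => ((g i).1 * (f (g i).2).1, (f (g i).2).2)
  id_comp f := by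
    funext i
    simp
  comp_id f := by
    funext i
    simp
  assoc f g h := by
    funext i
    simp [mul_assoc]
  t α := fun i => (1, α i)
  t_id n := rfl
  t_comp α β := by
    funext i
    simp
  isPower m n := by
    constructor
    · intro f g h
      funext i
      simpa using congrFun (congrFun h i) 0
    · intro f
      refine ⟨fun i => f i 0, ?_⟩
      funext i j
      have hj : j = 0 := Subsingleton.elim _ _
      subst hj
      simp

end LawvereTheory

/-!
Both parts rest on the same principle. A comonoidal structure on a monad `T` on sets is unique, and
the fusion operators say that a formal operation `t : T (T Y)` is the same thing as a unary
operation (its *shape*, obtained by identifying all variables of `t`) together with an element of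
`T Y` (its value). For a Lawvere theory whose models have exponentials computed as in sets, the
principle takes the form that functions on the underlying set of a model `M` extend uniquely to
homomorphisms on the product of `M` with the free model on one generator.

Four consequences determine `T`, once some algebra is nontrivial.
* Idempotent operations `ρ` are projections: `ρ`, as a formal operation on elements of `T Y`, has
  the same shape and value as the single element `ρ : T Y`, and functions on `T Y` may separate `ρ`
  from the variables.
* A unary operation depends on its variable: otherwise all values would be determined by the shape.
* Every unary operation `g` has a right inverse, so that unary operations form a group `G`. Take a
  formal operation `t` on the set of unary operations with shape `g` and value the identity. If each
  argument `s` of `t` is applied to a variable named `s`, the result is idempotent, hence the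
  variable with some name `h`. Since `t` is determined by its shape and its value, it can depend
  only on its argument `h`, so that its value is `g ∘ h`.
* Every operation is `g` applied to a variable, for a unique `g : G` and a unique variable: compose
  it with the inverse of its shape.

For monads the argument is carried out with Kleisli extensions (`SetMonad.bind`); see
`SetMonad.FusionBijective.exists_right_inverse` and `SetMonad.FusionBijective.bijective_unary`. For
theories only free models on finitely many generators, that is, representable ones, are used; see
`LawvereTheory.exists_extension`, `LawvereTheory.exists_right_inverse` and
`LawvereTheory.exists_eq_proj_comp`.
-/

/-! ### Monads on sets with bijective fusion operators -/

namespace SetMonad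

variable (M : Monad (Type u)) {X Y Z : Type u}

/-- The unit of a monad on sets, as a function. -/
def pure (x : X) : M.obj X := M.η.app X x

/-- Kleisli extension: the substitution of the operations `f x` for the variables `x` of the formal
operation `t`. -/
def bind (t : M.obj X) (f : X → M.obj Y) : M.obj Y := M.μ.app Y (M.map (↾f) t)

lemma map_apply (f : X ⟶ Y) (t : M.obj X) :
    M.map f t = bind M t fun x => pure M (f x) := by
  have h : (↾fun x => pure M (f x)) = f ≫ M.η.app Y := rfl
  rw [bind, h, M.map_comp]
  exact (congrArg (fun k : M.obj Y ⟶ M.obj Y => k (M.map f t)) (M.right_unit Y)).symm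

lemma mu_apply (t : M.obj (M.obj X)) : M.μ.app X t = bind M t fun s => s := by
  have h : (↾fun s : M.obj X => s) = 𝟙 (M.obj X) := rfl
  rw [bind, h, M.map_id]
  rfl

@[simp]
lemma bind_pure (t : M.obj X) : bind M t (pure M) = t := by
  have h : bind M t (pure M) = M.map (𝟙 X) t := (map_apply M (𝟙 X) t).symm
  rw [h, M.map_id]
  rfl

@[simp]
lemma bind_pure_unit (t : M.obj PUnit) : (bind M t fun _ => pure M PUnit.unit) = t :=
  bind_pure M t

@[simp]
lemma pure_bind (x : X) (f : X → M.obj Y) : bind M (pure M x) f = f x := by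
  have h := congrArg (fun k : X ⟶ M.obj (M.obj Y) => k x) (M.η.naturality (↾f))
  exact (congrArg (M.μ.app Y) h.symm).trans
    (congrArg (fun k : M.obj Y ⟶ M.obj Y => k (f x)) (M.left_unit Y))

@[simp]
lemma bind_assoc (t : M.obj X) (f : X → M.obj Y) (g : Y → M.obj Z) :
    bind M (bind M t f) g = bind M t fun x => bind M (f x) g := by
  have h₁ := congrArg (fun k : M.obj (M.obj Y) ⟶ M.obj (M.obj Z) => k (M.map (↾f) t))
    (M.μ.naturality (↾g))
  have h₂ := congrArg (fun k : M.obj (M.obj (M.obj Z)) ⟶ M.obj Z =>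
    k (M.map (M.map (↾g)) (M.map (↾f) t))) (M.assoc Z)
  have h₃ : (↾fun x => bind M (f x) g) = ↾f ≫ M.map (↾g) ≫ M.μ.app Z := rfl
  rw [bind, bind, bind, h₃, M.map_comp, M.map_comp]
  exact (congrArg (M.μ.app Z) h₁.symm).trans h₂.symm

/-- A nontrivial algebra separates the variables: any two distinct elements of `X` are separated by
a function to the algebra, which factors through the unit. -/
lemma pure_injective (A : M.Algebra) [Nontrivial A.A] : Function.Injective (pure M (X := X)) := by
  classical
  intro x y h
  obtain ⟨a, b, hab⟩ := exists_pair_ne A.A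
  by_contra hxy
  let f : X ⟶ A.A := ↾fun z => if z = x then a else b
  have hf : ∀ z, A.a (M.map f (pure M z)) = f z := fun z =>
    (congrArg A.a (congrArg (fun k : X ⟶ M.obj A.A => k z) (M.η.naturality f)).symm).trans
      (congrArg (fun k : A.A ⟶ A.A => k (f z)) A.unit)
  have hfxy : f x = f y := by rw [← hf x, ← hf y, h]
  apply hab
  simpa [f, Ne.symm hxy] using hfxy

/-- The left fusion operators `T (X × T Y) → T X × T Y` of a monad on sets, for the only comonoidal
structure there is, are bijective. -/
def FusionBijective : Prop :=
  ∀ X Y : Type u, Function.Bijective fun t : M.obj (X × M.obj Y) =>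
    ((bind M t fun p => pure M p.1 : M.obj X), bind M t Prod.snd)

variable {M}

lemma FusionBijective.ext (hM : FusionBijective M) {s t : M.obj (X × M.obj Y)}
    (h₁ : (bind M s fun p => pure M p.1) = bind M t fun p => pure M p.1)
    (h₂ : bind M s Prod.snd = bind M t Prod.snd) : s = t :=
  (hM X Y).1 (Prod.ext h₁ h₂)

/-- The case `X = 1` of `FusionBijective.ext`: a formal operation on `T Y` is determined by the
unary operation obtained by identifying all its variables, and by its value. -/
lemma FusionBijective.ext_unary (hM : FusionBijective M) {s t : M.obj (M.obj Y)}
    (h₁ : (bind M s fun _ => pure M PUnit.unit) = bind M t fun _ => pure M PUnit.unit)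
    (h₂ : (bind M s fun y => y) = bind M t fun y => y) : s = t := by
  have h := hM.ext (s := bind M s fun y => pure M (PUnit.unit, y))
    (t := bind M t fun y => pure M (PUnit.unit, y)) (by simpa using h₁) (by simpa using h₂)
  simpa using congrArg (fun r => bind M r fun p => pure M p.2) h

lemma FusionBijective.exists_unary (hM : FusionBijective M) (g : M.obj PUnit) (y : M.obj Y) :
    ∃ t : M.obj (M.obj Y),
      (bind M t fun _ => pure M PUnit.unit) = g ∧ (bind M t fun y => y) = y := by
  obtain ⟨t, ht⟩ := (hM PUnit Y).2 (g, y)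
  exact ⟨bind M t fun p => pure M p.2, by simpa using congrArg Prod.fst ht,
    by simpa using congrArg Prod.snd ht⟩

/-- An idempotent operation is a projection. By fusion, its variables may be viewed as elements of
`T Y` without changing the formal operation; functions on `T Y` which agree on the variables
then agree on the operation itself. -/
lemma FusionBijective.exists_eq_pure (hM : FusionBijective M)
    (hp : ∀ X : Type u, Function.Injective (pure M (X := X))) (t : M.obj Y)
    (ht : (bind M t fun _ => pure M PUnit.unit) = pure M PUnit.unit) : ∃ y, t = pure M y := by
  classical
  have h : (bind M t fun y => pure M (pure M y)) = pure M t :=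
    hM.ext_unary (by simpa using ht) (by simp)
  by_contra! hne
  -- The two functions are the constant `true` and the indicator of `{t}ᶜ`.
  have h₁ := congrArg (fun r => bind M r fun _ => pure M (ULift.up true)) h
  have h₂ := congrArg (fun r => bind M r fun s => pure M (ULift.up (decide (s ≠ t)))) h
  simp only [bind_assoc, pure_bind, (hne _).symm, ne_eq, not_false_eq_true, decide_true] at h₁ h₂
  simpa using hp _ (h₁.symm.trans h₂)

/-- A unary operation `g` depends on its variable. If it did not, then neither would any formal
operation which becomes `g` when its variables are identified, so that its value would be
independent of its arguments, whereas by fusion all values are possible. -/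
lemma FusionBijective.unary_injective (hM : FusionBijective M)
    (hp : ∀ X : Type u, Function.Injective (pure M (X := X))) (g : M.obj PUnit) {x y : X}
    (h : (bind M g fun _ => pure M x) = bind M g fun _ => pure M y) : x = y := by
  classical
  by_contra hxy
  have key (m n : M.obj (ULift.{u} Bool)) : m = bind M g fun _ => n := by
    obtain ⟨t, htg, htm⟩ := hM.exists_unary g m
    have h' : (bind M t fun s => pure M (x, s)) = bind M t fun s => pure M (y, s) :=
      hM.ext (by simpa [← htg] using h) (by simp)
    have hr := congrArg (fun r => bind M r fun p => if p.1 = x then p.2 else n) h'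
    simp only [bind_assoc, pure_bind, if_true, Ne.symm hxy, if_false] at hr
    rw [← htm, hr, ← htg]
    simp
  have := hp _ ((key (pure M ⟨true⟩) (pure M ⟨true⟩)).trans
    (key (pure M ⟨false⟩) (pure M ⟨true⟩)).symm)
  simp at this

lemma FusionBijective.unary_injective₂ (hM : FusionBijective M)
    (hp : ∀ X : Type u, Function.Injective (pure M (X := X))) {g h : M.obj PUnit} {x y : X}
    (e : (bind M g fun _ => pure M x) = bind M h fun _ => pure M y) : g = h ∧ x = y := by
  have hgh : g = h := by
    simpa using congrArg (fun r => bind M r fun _ => pure M PUnit.unit) e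
  subst hgh
  exact ⟨rfl, hM.unary_injective hp g e⟩

/-- Every unary operation `g` has a right inverse. Fusion gives a formal operation `t` on the unary
operations which becomes `g` when its variables are identified and whose value is the identity. If
each argument `s` is applied to a variable named `s`, one gets an idempotent operation, hence a
variable `h`. So `t` depends only on its argument `h`, and its value is `g ∘ h`. -/
lemma FusionBijective.exists_right_inverse (hM : FusionBijective M)
    (hp : ∀ X : Type u, Function.Injective (pure M (X := X))) (g : M.obj PUnit) :
    ∃ h : M.obj PUnit, (bind M g fun _ => h) = pure M PUnit.unit := by
  classical
  obtain ⟨t, htg, ht⟩ := hM.exists_unary g (pure M PUnit.unit)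
  obtain ⟨h, hh⟩ := hM.exists_eq_pure hp
    (bind M t fun s => bind M s fun _ => pure M s) (by simpa using ht)
  refine ⟨h, ?_⟩
  -- `f i` renames the variable of `h` to `0` and the variable of any other operation to `i`.
  let f (i : ULift.{u} (Fin 3)) (s : M.obj PUnit) : M.obj (ULift.{u} (Fin 3)) :=
    bind M s fun _ => pure M (if s = h then ⟨0⟩ else i)
  have hf (i) : bind M t (f i) = pure M ⟨0⟩ := by
    simpa using congrArg (fun r => bind M r fun s => pure M (if s = h then ⟨0⟩ else i)) hh
  have hff : (bind M t fun s => pure M (f ⟨1⟩ s)) = bind M t fun s => pure M (f ⟨2⟩ s) :=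
    hM.ext_unary (by simp) (by simp [hf])
  -- `r` inverts `f 1` and sends everything outside of its range to `h`.
  let r (z : M.obj (ULift.{u} (Fin 3))) : M.obj PUnit :=
    if ∃ s, f ⟨1⟩ s = z then bind M z fun _ => pure M PUnit.unit else h
  have hr₁ (s) : r (f ⟨1⟩ s) = s := by simp [r, f]
  have hr₂ (s) : r (f ⟨2⟩ s) = h := by
    by_cases hs : s = h
    · have h₀ : f ⟨2⟩ s = f ⟨1⟩ s := by simp [f, hs]
      rw [h₀, hr₁, hs]
    · refine if_neg ?_
      rintro ⟨s', hs'⟩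
      obtain ⟨rfl, h₂⟩ := hM.unary_injective₂ hp hs'
      simp [hs] at h₂
  have hfin := congrArg (fun z => bind M z r) hff
  simp only [bind_assoc, pure_bind, hr₁, hr₂] at hfin
  rw [← ht, hfin, ← htg]
  simp

/-- The group of unary operations, with composition as multiplication. -/
@[reducible]
noncomputable def unaryGroup (hM : FusionBijective M)
    (hp : ∀ X : Type u, Function.Injective (pure M (X := X))) : Group (M.obj PUnit) :=
  letI : Mul (M.obj PUnit) := ⟨fun g h => bind M g fun _ => h⟩
  letI : One (M.obj PUnit) := ⟨pure M PUnit.unit⟩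
  letI : Inv (M.obj PUnit) := ⟨fun g => (hM.exists_right_inverse hp g).choose⟩
  Group.ofRightAxioms (fun _ _ _ => bind_assoc M _ _ _) (fun _ => bind_pure M _)
    (fun g => (hM.exists_right_inverse hp g).choose_spec)

/-- Every operation is a unary operation applied to a projection, in a unique way: composing it with
the inverse of the unary operation obtained by identifying its variables gives an idempotent
operation. -/
lemma FusionBijective.bijective_unary (hM : FusionBijective M)
    (hp : ∀ X : Type u, Function.Injective (pure M (X := X))) (X : Type u) :
    Function.Bijective fun p : M.obj PUnit × X => bind M p.1 fun _ => pure M p.2 := by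
  refine ⟨fun p q h => Prod.ext_iff.2 (hM.unary_injective₂ hp h), fun t => ?_⟩
  let := unaryGroup hM hp
  let g : M.obj PUnit := bind M t fun _ => pure M PUnit.unit
  have h₁ : (bind M g⁻¹ fun _ => g) = pure M PUnit.unit := inv_mul_cancel g
  have h₂ : (bind M g fun _ => g⁻¹) = pure M PUnit.unit := mul_inv_cancel g
  obtain ⟨x, hx⟩ := hM.exists_eq_pure hp (bind M g⁻¹ fun _ => t) (by simpa using h₁)
  refine ⟨(g, x), ?_⟩
  simpa [hx] using congrArg (fun r => bind M r fun _ => t) h₂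

end SetMonad

/-! ### Hopf monads on sets -/

namespace Bimonad

open SetMonad

/-- The comonoidal structure of a bimonad on sets is determined by its functor, by naturality and
counitality. -/
lemma oplax_δ_apply (T : Bimonad (Type u)) (X Y : Type u) (t : T.monad.obj (X × Y)) :
    T.oplax.δ X Y t =
      (bind T.monad t fun p => pure T.monad p.1, bind T.monad t fun p => pure T.monad p.2) := by
  refine Prod.ext ?_ ?_
  · have h₁ := congrArg (fun k : T.monad.obj (X × Y) ⟶ _ => (k t).1)
      (T.oplax.δ_natural_right X (↾fun _ : Y => PUnit.unit))
    have h₂ := congrArg (fun k : T.monad.obj X ⟶ T.monad.obj X ⊗ 𝟙_ _ =>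
      (k (T.monad.map (↾fun p : X × Y => p.1) t)).1) (T.oplax.oplax_right_unitality X)
    have h₃ : T.monad.map (ρ_ X).inv (T.monad.map (↾fun p : X × Y => p.1) t) =
        T.monad.map (X ◁ (↾fun _ : Y => PUnit.unit)) t :=
      congrArg (fun k : T.monad.obj (X × Y) ⟶ T.monad.obj (X × PUnit) => k t)
        (T.monad.map_comp (↾fun p : X × Y => p.1) (ρ_ X).inv).symm
    refine Eq.trans ?_ (map_apply T.monad (↾fun p : X × Y => p.1) t)
    refine h₁.trans (Eq.trans ?_ h₂.symm)
    exact congrArg (fun s => (T.oplax.δ X PUnit s).1) h₃.symm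
  · have h₁ := congrArg (fun k : T.monad.obj (X × Y) ⟶ _ => (k t).2)
      (T.oplax.δ_natural_left (↾fun _ : X => PUnit.unit) Y)
    have h₂ := congrArg (fun k : T.monad.obj Y ⟶ 𝟙_ _ ⊗ T.monad.obj Y =>
      (k (T.monad.map (↾fun p : X × Y => p.2) t)).2) (T.oplax.oplax_left_unitality Y)
    have h₃ : T.monad.map (λ_ Y).inv (T.monad.map (↾fun p : X × Y => p.2) t) =
        T.monad.map ((↾fun _ : X => PUnit.unit) ▷ Y) t :=
      congrArg (fun k : T.monad.obj (X × Y) ⟶ T.monad.obj (PUnit × Y) => k t)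
        (T.monad.map_comp (↾fun p : X × Y => p.2) (λ_ Y).inv).symm
    refine Eq.trans ?_ (map_apply T.monad (↾fun p : X × Y => p.2) t)
    refine h₁.trans (Eq.trans ?_ h₂.symm)
    exact congrArg (fun s => (T.oplax.δ PUnit Y s).2) h₃.symm

lemma fusionBijective (T : Bimonad (Type u)) (hT : T.IsHopf) : FusionBijective T.monad := by
  intro X Y
  have := hT.1 X Y
  have h := (isIso_iff_bijective (T.leftFusion X Y)).1 this
  have e : ⇑(T.leftFusion X Y).hom = fun t : T.monad.obj (X × T.monad.obj Y) =>
      ((bind T.monad t fun p => pure T.monad p.1 : T.monad.obj X), bind T.monad t Prod.snd) := by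
    funext t
    have h₁ : T.leftFusion X Y t = ((T.oplax.δ X (T.monad.obj Y) t).1,
      T.monad.μ.app Y (T.oplax.δ X (T.monad.obj Y) t).2) := rfl
    refine h₁.trans ?_
    rw [oplax_δ_apply, mu_apply]
    simp
  exact e ▸ h

/-- The inverse of a comonoidal isomorphism of monads is comonoidal. -/
lemma IsIsomorphic.symm {C : Type u} [Category.{v} C] [MonoidalCategory C] {S T : Bimonad C}
    (h : S.IsIsomorphic T) : T.IsIsomorphic S := by
  obtain ⟨e, he, he'⟩ := h
  have h₁ (X : C) : e.hom.app X ≫ e.inv.app X = 𝟙 _ :=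
    congrArg (fun f : S.monad ⟶ S.monad => f.app X) e.hom_inv_id
  have h₂ (X : C) : e.inv.app X ≫ e.hom.app X = 𝟙 _ :=
    congrArg (fun f : T.monad ⟶ T.monad => f.app X) e.inv_hom_id
  refine ⟨e.symm, fun X Y => ?_, ?_⟩
  · calc e.inv.app (X ⊗ Y) ≫ S.oplax.δ X Y
        = e.inv.app (X ⊗ Y) ≫ (S.oplax.δ X Y ≫ (e.hom.app X ⊗ₘ e.hom.app Y)) ≫
            (e.inv.app X ⊗ₘ e.inv.app Y) := by
          rw [Category.assoc, tensorHom_comp_tensorHom, h₁, h₁, id_tensorHom_id, Category.comp_id]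
      _ = T.oplax.δ X Y ≫ (e.inv.app X ⊗ₘ e.inv.app Y) := by
          rw [← he, Category.assoc, ← Category.assoc, h₂, Category.id_comp]
  · calc e.inv.app (𝟙_ C) ≫ S.oplax.η = (e.inv.app (𝟙_ C) ≫ e.hom.app (𝟙_ C)) ≫ T.oplax.η := by
          rw [Category.assoc, he']
      _ = T.oplax.η := by rw [h₂, Category.id_comp]

/-- A Hopf monad with injective unit is isomorphic to `G × -`, where `G` is the group of unary
operations; the isomorphism sends `(g, x)` to `g` applied to the variable `x`. -/
lemma exists_isIsomorphic_ofGroup (T : Bimonad (Type u)) (hM : FusionBijective T.monad)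
    (hp : ∀ X : Type u, Function.Injective (pure T.monad (X := X))) :
    ∃ (G : Type u) (_ : Group G), T.IsIsomorphic (ofGroup G) := by
  let := unaryGroup hM hp
  let ψ (X : Type u) : (ofGroup (T.monad.obj PUnit)).monad.obj X ⟶ T.monad.obj X :=
    ↾fun p : T.monad.obj PUnit × X => bind T.monad p.1 fun _ => pure T.monad p.2
  have (X : Type u) : IsIso (ψ X) :=
    (isIso_iff_bijective _).2 (hM.bijective_unary hp X)
  have hnat {X Y : Type u} (f : X ⟶ Y) :
      (ofGroup (T.monad.obj PUnit)).monad.map f ≫ ψ Y = ψ X ≫ T.monad.map f := by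
    ext p
    refine Eq.trans ?_ (map_apply T.monad f (ψ X p)).symm
    change (bind T.monad p.1 fun _ => pure T.monad (f p.2)) =
      bind T.monad (bind T.monad p.1 fun _ => pure T.monad p.2) _
    simp
  let e : (ofGroup (T.monad.obj PUnit)).monad ≅ T.monad :=
    MonadIso.mk (NatIso.ofComponents (fun X => asIso (ψ X)) hnat) (fun X => by
      ext x
      exact pure_bind T.monad PUnit.unit fun _ => pure T.monad x) (fun X => by
      ext p
      refine Eq.trans ?_ (mu_apply T.monad _).symm
      change (bind T.monad (bind T.monad p.1 fun _ => p.2.1) fun _ => pure T.monad p.2.2) =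
        bind T.monad (bind T.monad p.1 fun _ => pure T.monad
          (bind T.monad p.2.1 fun _ => pure T.monad p.2.2)) fun s => s
      simp)
  refine ⟨_, _, IsIsomorphic.symm ⟨e, fun X Y => ?_, rfl⟩⟩
  refine ConcreteCategory.hom_ext _ _ fun p => ?_
  refine (oplax_δ_apply T X Y _).trans ?_
  change (bind T.monad (bind T.monad p.1 fun _ => pure T.monad p.2) _,
      bind T.monad (bind T.monad p.1 fun _ => pure T.monad p.2) _) =
    ((bind T.monad p.1 fun _ => pure T.monad p.2.1), bind T.monad p.1 fun _ => pure T.monad p.2.2)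
  simp

/-- Forgetting the group component is an augmentation of `G × -`. -/
lemma IsIsomorphic.isAugmented {T : Bimonad (Type u)} {G : Type u} [Group G]
    (h : T.IsIsomorphic (ofGroup G)) : T.IsAugmented := by
  obtain ⟨e, he, he'⟩ := h
  let ε : (ofGroup G).monad ⟶ (identity (Type u)).monad :=
    { app := fun X => ↾fun p : G × X => p.2
      naturality := fun _ _ _ => rfl
      app_η := fun _ => rfl
      app_μ := fun _ => rfl }
  refine ⟨e.hom ≫ ε, fun X Y => ?_, rfl⟩
  refine ConcreteCategory.hom_ext _ _ fun t => ?_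
  exact congrArg (fun f : T.monad.obj (X × Y) ⟶ (G × X) × (G × Y) =>
    (((f t).1.2, (f t).2.2) : X × Y)) (he X Y)

end Bimonad

/-! ### Operations and models of a Lawvere theory -/

namespace LawvereTheory

variable {𝕋 : LawvereTheory.{u}}

lemma hom_ext {m n : ℕ} {f g : 𝕋.Hom m n}
    (h : ∀ i, 𝕋.comp f (𝕋.proj i) = 𝕋.comp g (𝕋.proj i)) : f = g :=
  (𝕋.isPower m n).1 (funext h)

lemma t_comp_proj {m n : ℕ} (α : Fin m → Fin n) (i : Fin m) :
    𝕋.comp (𝕋.t α) (𝕋.proj i) = 𝕋.proj (α i) :=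
  (𝕋.t_comp (fun _ : Fin 1 => i) α).symm

lemma proj_zero : 𝕋.proj (0 : Fin 1) = 𝕋.id 1 := by
  rw [← 𝕋.t_id]
  exact congrArg 𝕋.t (funext fun i => Subsingleton.elim _ _)

variable (𝕋) in
/-- The morphism `1 ⟶ n` which identifies all variables of an `n`-ary operation. -/
def diag (n : ℕ) : 𝕋.Hom 1 n := 𝕋.t fun _ => 0

lemma diag_comp_proj {n : ℕ} (i : Fin n) : 𝕋.comp (𝕋.diag n) (𝕋.proj i) = 𝕋.id 1 := by
  rw [diag, t_comp_proj, proj_zero]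

lemma diag_comp_proj_comp {n k : ℕ} (i : Fin n) (f : 𝕋.Hom 1 k) :
    𝕋.comp (𝕋.diag n) (𝕋.comp (𝕋.proj i) f) = f := by
  rw [← 𝕋.assoc, diag_comp_proj, 𝕋.id_comp]

/-- The elements of `M(n)` are the `n`-tuples of elements of `M(1)`. -/
lemma Model.bijective_proj (M : 𝕋.Model) (n : ℕ) :
    Function.Bijective fun (x : M.obj.obj ⟨n⟩) (i : Fin n) =>
      M.obj.map (Y := ⟨1⟩) (𝕋.proj i) x := by
  have := M.property.preserves n
  let c : Fan fun _ : Fin n => (⟨1⟩ : 𝕋.Obj) := Fan.mk ⟨n⟩ fun i => 𝕋.proj i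
  have hc : IsLimit c :=
    Fan.IsLimit.mk c (fun s => ((𝕋.isPower s.pt.arity n).2 fun i => s.proj i).choose)
      (fun s i => congrFun ((𝕋.isPower s.pt.arity n).2 fun i => s.proj i).choose_spec i)
      (fun s m hm => hom_ext fun i => (hm i).trans
        (congrFun ((𝕋.isPower s.pt.arity n).2 fun i => s.proj i).choose_spec i).symm)
  have h := isLimitOfPreserves M.obj hc
  refine (Function.bijective_iff_existsUnique _).2 fun y => ?_
  obtain ⟨x, hx, hu⟩ := (Types.isLimit_iff _).1 ⟨h⟩ (fun j => y j.as) (by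
    rintro ⟨i⟩ ⟨j⟩ f
    obtain rfl : i = j := Discrete.eq_of_hom f
    obtain rfl : f = 𝟙 _ := Subsingleton.elim _ _
    simp)
  exact ⟨x, funext fun i => hx ⟨i⟩, fun z hz => hu z fun j => congrFun hz j.as⟩

variable (𝕋) in
/-- The free model on `n` generators, represented by the object `n`. -/
def free (n : ℕ) : 𝕋.Model :=
  ⟨coyoneda.obj (Opposite.op ⟨n⟩), ⟨fun _ => inferInstance⟩⟩

/-- The homomorphism from the free model determined by an `n`-tuple of elements. -/
def freeLift {M : 𝕋.Model} {n : ℕ} (x : M.obj.obj ⟨n⟩) : 𝕋.free n ⟶ M :=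
  ObjectProperty.homMk (coyonedaEquiv.symm x)

lemma free_hom_ext {M : 𝕋.Model} {Φ Ψ : 𝕋.free 1 ⟶ M}
    (h : 𝕋.forget.map Φ (𝕋.id 1) = 𝕋.forget.map Ψ (𝕋.id 1)) : Φ = Ψ :=
  ObjectProperty.hom_ext _ (coyonedaEquiv.injective h)

lemma hom_map_apply {M N : 𝕋.Model} (Φ : M ⟶ N) {m n : ℕ} (f : 𝕋.Hom m n) (x : M.obj.obj ⟨m⟩) :
    Φ.hom.app ⟨n⟩ (M.obj.map (X := ⟨m⟩) (Y := ⟨n⟩) f x) =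
      N.obj.map (X := ⟨m⟩) (Y := ⟨n⟩) f (Φ.hom.app ⟨m⟩ x) :=
  congrArg (fun k : M.obj.obj ⟨m⟩ ⟶ N.obj.obj ⟨n⟩ => k x) (Φ.hom.naturality (X := ⟨m⟩) (Y := ⟨n⟩) f)

/-- The elements `(x, f)` of the underlying set of `M ⊗ free 1`. -/
abbrev pair {M : 𝕋.Model} (x : 𝕋.forget.obj M) (f : 𝕋.Hom 1 1) : 𝕋.forget.obj (M ⊗ 𝕋.free 1) :=
  (x, f)

/-! ### Theories with exponentials computed as for sets -/

section

variable [MonoidalClosed 𝕋.Model]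

/-- The action of an element of the exponential of two models on the elements of the first. -/
def evalAt {M N : 𝕋.Model} (k : 𝕋.forget.obj ((ihom M).obj N)) (x : 𝕋.forget.obj M) :
    𝕋.forget.obj N :=
  𝕋.forget.map ((ihom.ev M).app N) (show 𝕋.forget.obj (M ⊗ (ihom M).obj N) from (x, k))

lemma curry_apply {M N : 𝕋.Model} (Φ : M ⊗ 𝕋.free 1 ⟶ N) (x : 𝕋.forget.obj M) (f : 𝕋.Hom 1 1) :
    𝕋.forget.map Φ (pair x f) = evalAt (𝕋.forget.map (MonoidalClosed.curry Φ) f) x := by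
  conv_lhs => rw [← MonoidalClosed.uncurry_curry Φ, MonoidalClosed.uncurry_eq]
  rfl

/-- A unary operation depends on its variable. If it did not, then two homomorphisms on
`N ⊗ free 1` with values in `N` would agree at every `(x, g)`, as can be seen by transposing them.
The first projection and the homomorphisms which factor through the second do not. -/
lemma proj_comp_injective (hN : 𝕋.IsNondegenerate) {n : ℕ} {i j : Fin n} {g : 𝕋.Hom 1 1}
    (h : 𝕋.comp (𝕋.proj i) g = 𝕋.comp (𝕋.proj j) g) : i = j := by
  by_contra hij
  have hconst (N : 𝕋.Model) (a b : 𝕋.forget.obj N) :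
      N.obj.map (X := ⟨1⟩) (Y := ⟨1⟩) g a = N.obj.map (X := ⟨1⟩) (Y := ⟨1⟩) g b := by
    obtain ⟨x, hx⟩ := (N.bijective_proj n).2 fun k => if k = i then a else b
    have hxi : N.obj.map (Y := ⟨1⟩) (𝕋.proj i) x = a := by simpa using congrFun hx i
    have hxj : N.obj.map (Y := ⟨1⟩) (𝕋.proj j) x = b := by
      simpa [Ne.symm hij] using congrFun hx j
    have hg (k : Fin n) : N.obj.map (X := ⟨1⟩) (Y := ⟨1⟩) g (N.obj.map (Y := ⟨1⟩) (𝕋.proj k) x) =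
        N.obj.map (X := ⟨n⟩) (Y := ⟨1⟩) (𝕋.comp (𝕋.proj k) g) x :=
      (congrArg (fun f : N.obj.obj ⟨n⟩ ⟶ N.obj.obj ⟨1⟩ => f x)
        (N.obj.map_comp (X := ⟨n⟩) (Y := ⟨1⟩) (Z := ⟨1⟩) (𝕋.proj k) g)).symm
    rw [← hxi, ← hxj, hg, hg, h]
  have hcurry {M N : 𝕋.Model} (Φ Ψ : M ⊗ 𝕋.free 1 ⟶ N) (x : 𝕋.forget.obj M) :
      𝕋.forget.map Φ (pair x g) = 𝕋.forget.map Ψ (pair x g) := by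
    have hΦ (Θ : 𝕋.free 1 ⟶ (ihom M).obj N) : 𝕋.forget.map Θ g =
        ((ihom M).obj N).obj.map (X := ⟨1⟩) (Y := ⟨1⟩) g (𝕋.forget.map Θ (𝕋.id 1)) := by
      refine Eq.trans ?_ (hom_map_apply Θ g (𝕋.id 1))
      exact congrArg (Θ.hom.app ⟨1⟩) (𝕋.id_comp g).symm
    rw [curry_apply, curry_apply, hΦ, hΦ, hconst]
  obtain ⟨N, hN⟩ := hN
  obtain ⟨a, b, hab⟩ := exists_pair_ne (𝕋.forget.obj N)
  have hfst (x : 𝕋.forget.obj N) : x = N.obj.map (X := ⟨1⟩) (Y := ⟨1⟩) g a :=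
    hcurry (CartesianMonoidalCategory.fst N (𝕋.free 1))
      (CartesianMonoidalCategory.snd N (𝕋.free 1) ≫ freeLift (n := 1) a) x
  exact hab ((hfst a).trans (hfst b).symm)

lemma proj_comp_injective₂ (hN : 𝕋.IsNondegenerate) {n : ℕ} {i j : Fin n} {g h : 𝕋.Hom 1 1}
    (e : 𝕋.comp (𝕋.proj i) g = 𝕋.comp (𝕋.proj j) h) : g = h ∧ i = j := by
  have hgh : g = h := by
    rw [← diag_comp_proj_comp i g, e, diag_comp_proj_comp]
  subst hgh
  exact ⟨rfl, proj_comp_injective hN e⟩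

variable [MonoidalClosedFunctor 𝕋.forget]

/-- The elements of the exponential of two models are the functions between the underlying sets. -/
lemma bijective_evalAt (M N : 𝕋.Model) : Function.Bijective (evalAt (M := M) (N := N)) := by
  have h := (isIso_iff_bijective ((expComparison 𝕋.forget M).natTrans.app N)).1 inferInstance
  have h' := expComparison_ev 𝕋.forget M N
  rw [IsIso.eq_inv_comp] at h'
  have h'' : Function.Bijective
      fun (f : 𝕋.forget.obj M ⟶ 𝕋.forget.obj N) (x : 𝕋.forget.obj M) => f x :=
    ⟨fun f g hfg => ConcreteCategory.hom_ext _ _ (congrFun hfg), fun f => ⟨↾f, rfl⟩⟩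
  have e : (evalAt : 𝕋.forget.obj ((ihom M).obj N) → _) =
      (fun (f : 𝕋.forget.obj M ⟶ 𝕋.forget.obj N) (x : 𝕋.forget.obj M) => f x) ∘
        (expComparison 𝕋.forget M).natTrans.app N := by
    funext k x
    exact (congrArg
      (fun f : 𝕋.forget.obj (M ⊗ (ihom M).obj N) ⟶ 𝕋.forget.obj N => f (x, k)) h').symm
  exact e ▸ h''.comp h

/-- Every function on the underlying set of `M` extends to a homomorphism on `M ⊗ free 1`, since
exponentials of models are computed as for sets. -/
lemma exists_extension {M N : 𝕋.Model} (φ : 𝕋.forget.obj M → 𝕋.forget.obj N) :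
    ∃ Φ : M ⊗ 𝕋.free 1 ⟶ N, ∀ x, 𝕋.forget.map Φ (pair x (𝕋.id 1)) = φ x := by
  obtain ⟨k, hk⟩ := (bijective_evalAt M N).2 φ
  refine ⟨MonoidalClosed.uncurry (freeLift (n := 1) k), fun x => ?_⟩
  have hid : 𝕋.forget.map (freeLift (n := 1) k) (𝕋.id 1) = k :=
    congrArg (fun f : 𝕋.forget.obj ((ihom M).obj N) ⟶ 𝕋.forget.obj ((ihom M).obj N) => f k)
      (((ihom M).obj N).obj.map_id ⟨1⟩)
  rw [curry_apply, MonoidalClosed.curry_uncurry, hid]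
  exact congrFun hk x

/-- The extension in `exists_extension` is unique. -/
lemma extension_ext {M N : 𝕋.Model} {Φ Ψ : M ⊗ 𝕋.free 1 ⟶ N}
    (h : ∀ x, 𝕋.forget.map Φ (pair x (𝕋.id 1)) = 𝕋.forget.map Ψ (pair x (𝕋.id 1))) : Φ = Ψ := by
  refine MonoidalClosed.curry_injective (free_hom_ext ((bijective_evalAt M N).1 ?_))
  funext x
  rw [← curry_apply, ← curry_apply, h]

/-- An idempotent operation `ρ` is a projection. The extension to `free n ⊗ free 1` of a function on
`n`-ary operations has a value at `ρ` which is determined by its values at the projections. -/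
lemma exists_eq_proj (hN : 𝕋.IsNondegenerate) {n : ℕ} (ρ : 𝕋.Hom n 1)
    (hρ : 𝕋.comp (𝕋.diag n) ρ = 𝕋.id 1) : ∃ i, ρ = 𝕋.proj i := by
  classical
  obtain ⟨N, hN⟩ := hN
  obtain ⟨a, b, hab⟩ := exists_pair_ne (𝕋.forget.obj N)
  by_contra! hne
  have key (φ : 𝕋.Hom n 1 → 𝕋.forget.obj N) : ∃ x : N.obj.obj ⟨n⟩,
      (∀ i, N.obj.map (Y := ⟨1⟩) (𝕋.proj i) x = φ (𝕋.proj i)) ∧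
        N.obj.map (Y := ⟨1⟩) ρ x = φ ρ := by
    obtain ⟨Φ, hΦ⟩ := exists_extension (M := 𝕋.free n) φ
    -- The tuple of the pairs `(proj i, id)`. As `ρ` is idempotent, it sends `z` to `(ρ, id)`.
    let z : (𝕋.free n ⊗ 𝕋.free 1).obj.obj ⟨n⟩ := (𝕋.id n, 𝕋.diag n)
    have hz (f : 𝕋.Hom n 1) (hf : 𝕋.comp (𝕋.diag n) f = 𝕋.id 1) :
        N.obj.map (Y := ⟨1⟩) f (Φ.hom.app ⟨n⟩ z) = φ f := by
      rw [← hΦ f, ← hom_map_apply Φ f z]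
      refine congrArg (Φ.hom.app ⟨1⟩) (Prod.ext (𝕋.id_comp f) hf)
    exact ⟨_, fun i => hz _ (diag_comp_proj i), hz _ hρ⟩
  obtain ⟨x, hx, hx'⟩ := key fun _ => a
  obtain ⟨y, hy, hy'⟩ := key fun f => if f = ρ then b else a
  have hxy : x = y := (N.bijective_proj n).1 (funext fun i => by
    simp [hx, hy, Ne.symm (hne i)])
  apply hab
  rw [← hx', hxy, hy', if_pos rfl]

/-- Every unary operation `g` has a right inverse. Homomorphisms on `free 1 ⊗ free 1` are functions
on the set of unary operations; the extension of the squaring function, evaluated at `(id, g)`,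
gives the right inverse `h`. The homomorphisms which extend two functions to `free 3` that
share only the value at `h` agree at `(id, g)`. Hence so do the first projection to `free 1` and
the homomorphism which is constantly `h` on generators. -/
lemma exists_right_inverse (hN : 𝕋.IsNondegenerate) (g : 𝕋.Hom 1 1) :
    ∃ h, 𝕋.comp h g = 𝕋.id 1 := by
  classical
  let F := 𝕋.free 1
  obtain ⟨Θ, hΘ⟩ := exists_extension (M := F) (N := F) fun f : 𝕋.Hom 1 1 => 𝕋.comp f f
  let h : 𝕋.Hom 1 1 := 𝕋.forget.map Θ (pair (M := F) (𝕋.id 1) g)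
  refine ⟨h, ?_⟩
  let f (i : Fin 3) (s : 𝕋.Hom 1 1) : 𝕋.Hom 3 1 := 𝕋.comp (𝕋.proj (if s = h then 0 else i)) s
  have hf (i : Fin 3) : ∃ Φ : F ⊗ F ⟶ 𝕋.free 3,
      (∀ s, 𝕋.forget.map Φ (pair (M := F) s (𝕋.id 1)) = f i s) ∧
        𝕋.forget.map Φ (pair (M := F) (𝕋.id 1) g) = 𝕋.proj 0 := by
    -- `(x, y) ↦ (Θ (x, y), x)` sends `(s, id)` to `(s ∘ s, s)`, the operation `s` applied to the
    -- generator `(s, id)`, and it sends `(id, g)` to the generator `(h, id)`.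
    obtain ⟨K, hK⟩ := exists_extension (M := F) (N := 𝕋.free 3)
      fun s : 𝕋.Hom 1 1 => 𝕋.proj (if s = h then 0 else i)
    refine ⟨CartesianMonoidalCategory.lift Θ (CartesianMonoidalCategory.fst F F) ≫ K,
      fun s => ?_, ?_⟩
    · have h₁ : 𝕋.forget.map K (pair (M := F) (𝕋.comp s s) s) = f i s := by
        have h₂ := hom_map_apply K s (pair (M := F) s (𝕋.id 1))
        refine Eq.trans ?_ (h₂.trans (congrArg (fun z => 𝕋.comp z s) (hK s)))
        exact congrArg (𝕋.forget.map K) (Prod.ext rfl (𝕋.id_comp s).symm)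
      exact (congrArg (fun z => 𝕋.forget.map K (pair (M := F) z s)) (hΘ s)).trans h₁
    · exact (hK h).trans (by rw [if_pos rfl])
  obtain ⟨Φ₁, hΦ₁, hΦ₁'⟩ := hf 1
  obtain ⟨Φ₂, hΦ₂, hΦ₂'⟩ := hf 2
  -- `r` inverts `f 1` and sends everything outside of its range to `h`.
  let r (z : 𝕋.Hom 3 1) : 𝕋.Hom 1 1 := if ∃ s, f 1 s = z then 𝕋.comp (𝕋.diag 3) z else h
  have hr₁ (s) : r (f 1 s) = s := by simp [r, f, diag_comp_proj_comp]
  have hr₂ (s) : r (f 2 s) = h := by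
    by_cases hs : s = h
    · have h₀ : f 2 s = f 1 s := by simp [f, hs]
      rw [h₀, hr₁, hs]
    · refine if_neg ?_
      rintro ⟨s', hs'⟩
      obtain ⟨rfl, h₂⟩ := proj_comp_injective₂ hN hs'
      simp [hs] at h₂
  obtain ⟨R, hR⟩ := exists_extension (M := 𝕋.free 3) (N := F) r
  have h₁ : CartesianMonoidalCategory.lift Φ₁ (CartesianMonoidalCategory.snd F F) ≫ R =
      CartesianMonoidalCategory.fst F F :=
    extension_ext fun s => (congrArg (fun z => 𝕋.forget.map R (pair (M := 𝕋.free 3) z (𝕋.id 1)))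
      (hΦ₁ s)).trans ((hR _).trans (hr₁ s))
  have h₂ : CartesianMonoidalCategory.lift Φ₂ (CartesianMonoidalCategory.snd F F) ≫ R =
      CartesianMonoidalCategory.snd F F ≫ freeLift (n := 1) h :=
    extension_ext fun s => (congrArg (fun z => 𝕋.forget.map R (pair (M := 𝕋.free 3) z (𝕋.id 1)))
      (hΦ₂ s)).trans ((hR _).trans ((hr₂ s).trans (𝕋.comp_id h).symm))
  have e₁ : 𝕋.forget.map R (pair (M := 𝕋.free 3) (𝕋.proj 0) g) = 𝕋.id 1 :=
    (congrArg (fun z => 𝕋.forget.map R (pair (M := 𝕋.free 3) z g)) hΦ₁'.symm).trans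
      (congrArg (fun Ψ : F ⊗ F ⟶ F => 𝕋.forget.map Ψ (pair (M := F) (𝕋.id 1) g)) h₁)
  have e₂ : 𝕋.forget.map R (pair (M := 𝕋.free 3) (𝕋.proj 0) g) = 𝕋.comp h g :=
    (congrArg (fun z => 𝕋.forget.map R (pair (M := 𝕋.free 3) z g)) hΦ₂'.symm).trans
      (congrArg (fun Ψ : F ⊗ F ⟶ F => 𝕋.forget.map Ψ (pair (M := F) (𝕋.id 1) g)) h₂)
  exact e₂.symm.trans e₁

end

/-! ### Theories of group actions -/

/-- The group of unary operations of a theory in which they are invertible on one side. The product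
`g * h` is the operation `x ↦ g (h x)`, which is `comp h g`. -/
@[reducible]
noncomputable def unaryGroup (hinv : ∀ g : 𝕋.Hom 1 1, ∃ h, 𝕋.comp h g = 𝕋.id 1) :
    Group (𝕋.Hom 1 1) :=
  letI : Mul (𝕋.Hom 1 1) := ⟨fun g h => 𝕋.comp h g⟩
  letI : One (𝕋.Hom 1 1) := ⟨𝕋.id 1⟩
  letI : Inv (𝕋.Hom 1 1) := ⟨fun g => (hinv g).choose⟩
  Group.ofRightAxioms (fun f g h => (𝕋.assoc h g f).symm) (fun g => 𝕋.id_comp g)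
    (fun g => (hinv g).choose_spec)

lemma exists_inverse (hinv : ∀ g : 𝕋.Hom 1 1, ∃ h, 𝕋.comp h g = 𝕋.id 1) (g : 𝕋.Hom 1 1) :
    ∃ h, 𝕋.comp g h = 𝕋.id 1 ∧ 𝕋.comp h g = 𝕋.id 1 :=
  let := unaryGroup hinv
  ⟨g⁻¹, inv_mul_cancel g, mul_inv_cancel g⟩

/-- Composing an operation with the inverse of the unary operation obtained by identifying its
variables gives an idempotent operation, that is, a projection. -/
lemma exists_eq_proj_comp (hinv : ∀ g : 𝕋.Hom 1 1, ∃ h, 𝕋.comp h g = 𝕋.id 1)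
    (hproj : ∀ (n : ℕ) (ρ : 𝕋.Hom n 1), 𝕋.comp (𝕋.diag n) ρ = 𝕋.id 1 → ∃ i, ρ = 𝕋.proj i)
    {n : ℕ} (ρ : 𝕋.Hom n 1) :
    ∃ (i : Fin n) (f : 𝕋.Hom 1 1), ρ = 𝕋.comp (𝕋.proj i) f := by
  obtain ⟨h, h₁, h₂⟩ := exists_inverse hinv (𝕋.comp (𝕋.diag n) ρ)
  obtain ⟨i, hi⟩ := hproj n (𝕋.comp ρ h) (by rw [← 𝕋.assoc, h₁])
  exact ⟨i, _, by rw [← hi, 𝕋.assoc, h₂, 𝕋.comp_id]⟩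

/-- If the operations are exactly the composites of a projection with an invertible unary operation,
in a unique way, then the theory is that of `G`-sets for the group `G` of unary operations. -/
lemma exists_isIsomorphic_ofGroup (hinv : ∀ g : 𝕋.Hom 1 1, ∃ h, 𝕋.comp h g = 𝕋.id 1)
    (hbij : ∀ n, Function.Bijective fun p : 𝕋.Hom 1 1 × Fin n => 𝕋.comp (𝕋.proj p.2) p.1) :
    ∃ (G : Type u) (_ : Group G), 𝕋.IsIsomorphic (ofGroup G) := by
  let := unaryGroup hinv
  let e (n m : ℕ) : 𝕋.Hom n m ≃ (Fin m → 𝕋.Hom 1 1 × Fin n) :=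
    (Equiv.ofBijective _ (𝕋.isPower n m)).trans
      (Equiv.piCongrRight fun _ => (Equiv.ofBijective _ (hbij n)).symm)
  have he {n m : ℕ} (f : 𝕋.Hom n m) (i : Fin m) :
      𝕋.comp (𝕋.proj (e n m f i).2) (e n m f i).1 = 𝕋.comp f (𝕋.proj i) :=
    (Equiv.ofBijective _ (hbij n)).apply_symm_apply (𝕋.comp f (𝕋.proj i))
  have he' {n m : ℕ} (f : 𝕋.Hom n m) (p : Fin m → 𝕋.Hom 1 1 × Fin n)
      (h : ∀ i, 𝕋.comp f (𝕋.proj i) = 𝕋.comp (𝕋.proj (p i).2) (p i).1) : e n m f = p :=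
    funext fun i => (hbij n).1 ((he f i).trans (h i))
  have het (m n : ℕ) (α : Fin m → Fin n) : e n m (𝕋.t α) = fun i => (1, α i) :=
    he' _ _ fun i => (t_comp_proj α i).trans (𝕋.comp_id _).symm
  refine ⟨_, _, e, fun n => ?_, fun n m k f g => he' _ _ fun i => ?_, het⟩
  · rw [← 𝕋.t_id]
    exact het n n _
  · rw [𝕋.assoc, ← he g i, ← 𝕋.assoc, ← he f, 𝕋.assoc]
    rfl

end LawvereTheory

theorem theoremT :
    (∀ T : Bimonad (Type u), T.IsHopf → T.IsFinitary → T.IsNondegenerate →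
      (∃ (G : Type u) (_ : Group G), T.IsIsomorphic (Bimonad.ofGroup G)) ∧ T.IsAugmented) ∧
    (∀ 𝕋 : LawvereTheory.{u}, 𝕋.LiftsCartesianClosed → 𝕋.IsNondegenerate →
      (∃ (G : Type u) (_ : Group G), 𝕋.IsIsomorphic (LawvereTheory.ofGroup G)) ∧
      (∀ f : 𝕋.Hom 1 1, ∃ g : 𝕋.Hom 1 1,
        𝕋.comp f g = 𝕋.id 1 ∧ 𝕋.comp g f = 𝕋.id 1) ∧
      (∀ (n : ℕ) (ρ : 𝕋.Hom n 1), ∃ (i : Fin n) (f : 𝕋.Hom 1 1),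
        ρ = 𝕋.comp (𝕋.proj i) f)) := by
  refine ⟨fun T hT _ ⟨A, _⟩ => ?_, fun 𝕋 ⟨_, _⟩ hN => ?_⟩
  · obtain ⟨G, _, h⟩ := T.exists_isIsomorphic_ofGroup (T.fusionBijective hT)
      fun _ => SetMonad.pure_injective T.monad A
    exact ⟨⟨G, _, h⟩, h.isAugmented⟩
  · have hinv (g : 𝕋.Hom 1 1) := LawvereTheory.exists_right_inverse hN g
    have hρ {n : ℕ} (ρ : 𝕋.Hom n 1) := LawvereTheory.exists_eq_proj_comp hinv
      (fun _ ρ => LawvereTheory.exists_eq_proj hN ρ) ρ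
    refine ⟨LawvereTheory.exists_isIsomorphic_ofGroup hinv fun n => ⟨fun p q h => ?_, fun ρ => ?_⟩,
      LawvereTheory.exists_inverse hinv, fun _ => hρ⟩
    · exact Prod.ext_iff.2 (LawvereTheory.proj_comp_injective₂ hN h)
    · obtain ⟨i, f, h⟩ := hρ ρ
      exact ⟨(f, i), h.symm⟩
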